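/- Let $1\le d\le m$ be integers and $\lambda=d/m$. Let $p,q$ be monic real polynomials of degree $d$ all of whose roots are real and nonnegative. Choose real $m\times d$ matrices $A,B$ with $p(x)=\det(xI_d-A^TA)$ and $q(x)=\det(xI_d-B^TB)$, and define \[ [p\boxplus_{d,\lambda}q](x)=\int_{\mathcal O_m}\int_{\mathcal O_d}\det\!\big(xI_d-(A+QBR^T)^T(A+QBR^T)\big)\,dR\,dQ , \] where $dQ,dR$ are the Haar probability measures on the orthogonal groups $\mathcal O_m,\mathcal O_d$. For a polynomial $r$ put $(\mathbb S r)(x)=r(x^2)$, and for a real-rooted polynomial $r$ with roots $r_1,\dots,r_n$ (with multiplicity, $n=\deg r$) put $\mathbb E[r]=\frac1n\sum_i r_i$ and $\mathrm{Var}[r]=\frac1n\sum_i(r_i-\mathbb E[r])^2$. Then $p\boxplus_{d,\lambda}q$ does not depend on the choice of $A$ and $B$; it is a monic polynomial of degree $d$ with only real nonnegative roots (so that $\mathbb S[p\boxplus_{d,\lambda}q]$ is real-rooted); and \[ \mathbb E\big[\mathbb S[p\boxplus_{d,\lambda}q]\big]=\mathbb E[\mathbb S p]+\mathbb E[\mathbb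 S q]=0,\qquad \mathrm{Var}\big[\mathbb S[p\boxplus_{d,\lambda}q]\big]=\mathrm{Var}[\mathbb S p]+\mathrm{Var}[\mathbb S q]. \] -/

import Mathlib

open Polynomial MeasureTheory

noncomputable section

/-- The group `O_n` of real orthogonal `n × n` matrices. -/
abbrev OrthGroup (n : ℕ) : Type := Matrix.orthogonalGroup (Fin n) ℝ

instance OrthGroup.compactSpace (n : ℕ) : CompactSpace (OrthGroup n) := by
  have hK : IsCompact (Set.univ.pi fun _ : Fin n => Set.univ.pi fun _ : Fin n =>
      Set.Icc (-1 : ℝ) 1) :=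
    isCompact_univ_pi fun _ => isCompact_univ_pi fun _ => isCompact_Icc
  have hclosed : IsClosed
      ((Matrix.orthogonalGroup (Fin n) ℝ : Submonoid (Matrix (Fin n) (Fin n) ℝ)) :
        Set (Matrix (Fin n) (Fin n) ℝ)) := by
    have h : ((Matrix.orthogonalGroup (Fin n) ℝ : Submonoid (Matrix (Fin n) (Fin n) ℝ)) :
        Set (Matrix (Fin n) (Fin n) ℝ)) = {M | M * star M = 1} := by
      ext M
      exact Matrix.mem_unitaryGroup_iff
    rw [h]
    exact isClosed_eq (by fun_prop) continuous_const
  refine isCompact_iff_compactSpace.mp (IsCompact.of_isClosed_subset hK hclosed ?_)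
  intro M hM i _ j _
  have h := entry_norm_bound_of_unitary (𝕜 := ℝ) hM i j
  exact abs_le.mp h

instance OrthGroup.measurableSpace (n : ℕ) : MeasurableSpace (OrthGroup n) := borel _

instance OrthGroup.borelSpace (n : ℕ) : BorelSpace (OrthGroup n) := ⟨rfl⟩

/-- The Haar probability measure on `O_n`. -/
def orthHaar (n : ℕ) : Measure (OrthGroup n) := Measure.haarMeasure ⊤

/-- The characteristic polynomial `det (x I - Mᵀ M)` of `Mᵀ M`, for an `m × d` matrix `M`. -/
def singCharpoly {m d : ℕ} (M : Matrix (Fin m) (Fin d) ℝ) : ℝ[X] :=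
  (M.transpose * M).charpoly

/-- The average, coefficient by coefficient, of `det (x I - (A + Q B Rᵀ)ᵀ (A + Q B Rᵀ))` over
independent Haar distributed `Q ∈ O_m` and `R ∈ O_d`. -/
def haarConv {m d : ℕ} (A B : Matrix (Fin m) (Fin d) ℝ) : ℝ[X] :=
  ∑ k ∈ Finset.range (d + 1),
    C (∫ Q : OrthGroup m, ∫ R : OrthGroup d,
        (singCharpoly (A + (Q : Matrix (Fin m) (Fin m) ℝ) * B *
          (R : Matrix (Fin d) (Fin d) ℝ).transpose)).coeff k ∂(orthHaar d) ∂(orthHaar m)) * X ^ k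

open Classical in
/-- The rectangular additive convolution `p ⊞_{d,λ} q` with `λ = d / m`: write `p` and `q` as
characteristic polynomials of `Aᵀ A` and `Bᵀ B` for `m × d` matrices `A`, `B` and take
`haarConv A B`. -/
def rectConv (m d : ℕ) (p q : ℝ[X]) : ℝ[X] :=
  if h : (∃ A : Matrix (Fin m) (Fin d) ℝ, singCharpoly A = p) ∧
      (∃ B : Matrix (Fin m) (Fin d) ℝ, singCharpoly B = q) then
    haarConv h.1.choose h.2.choose
  else 0

/-- `p = ∏_{i=1}^d (x - λ_i)` with all `λ_i` real and nonnegative. -/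
structure IsNonnegRooted (d : ℕ) (p : ℝ[X]) : Prop where
  monic : p.Monic
  natDegree_eq : p.natDegree = d
  splits : p.Splits
  nonneg_of_mem_roots : ∀ x ∈ p.roots, 0 ≤ x

/-- The symmetrization `(S p)(x) = p(x²)`. -/
def symmetrization (p : ℝ[X]) : ℝ[X] := p.comp (X ^ 2)

/-- The mean of the roots (with multiplicity) of a real-rooted polynomial. -/
def rootMean (r : ℝ[X]) : ℝ :=
  r.roots.sum / r.natDegree

/-- The variance of the roots (with multiplicity) of a real-rooted polynomial. -/
def rootVar (r : ℝ[X]) : ℝ :=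
  (r.roots.map fun x => (x - rootMean r) ^ 2).sum / r.natDegree

end

/-! The Haar average is computed exactly, and the resulting formula is then analysed without
integrals. By a Schur complement, `det (y I - MᵀM)` is the determinant of `diag(1, y)` plus the
dilation of `M`. Expanding the determinant for `A + Q B Rᵀ` by rows, invariance under sign matrices
leaves only products of complementary principal minors (`orthMean_det_add`). Invariance under
permutations makes the mean minors depend only on size, so they are normalized coefficients of
`singCharpoly B` (`meanMinor_eq`). This gives the bilinear formula `rectForm` in the coefficients of
`p` and `q` (`haarConv_eq_rectForm`), hence independence of `A` and `B`.

For the roots, `x ^ (m - d) * p (x y)` has no zero with `x` and `y` in the open upper half plane.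
Each root `s ≥ 0` of `q` acts by taking one polar derivative in each variable and subtracting `s`
times the mixed derivative in the two poles. Both operations preserve zero-freeness
(`eval_polarDeriv_ne_zero`, `bilinear_sub_ne_zero`). After all roots of `q`, the value at `(w, z)`
is `w ^ (m - d)` times `rectForm` at `w z` (`eval_rectForm_ne_zero`). Taking `z = w` excludes every
root that is not a nonnegative real.

Symmetrized roots come in pairs `±√r`, so the mean is zero and the variance is `-p.coeff (d - 1) /
d`; this coefficient is additive under `rectForm` for monic inputs. -/

/-! ### Polar derivatives and the upper half plane -/

/-- The polar derivative of `f`, as a polynomial of formal degree `n`, with respect to `w`,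
divided by `n`. -/
noncomputable def polarDeriv (n : ℕ) (w : ℂ) : ℂ[X] →ₗ[ℂ] ℂ[X] :=
  LinearMap.id + (n : ℂ)⁻¹ • (LinearMap.mulLeft ℂ (C w - X)).comp derivative

theorem polarDeriv_apply (n : ℕ) (w : ℂ) (f : ℂ[X]) :
    polarDeriv n w f = f + (n : ℂ)⁻¹ • ((C w - X) * derivative f) := rfl

theorem eval_polarDeriv (n : ℕ) (w x : ℂ) (f : ℂ[X]) :
    (polarDeriv n w f).eval x = f.eval x + (n : ℂ)⁻¹ * ((w - x) * (derivative f).eval x) := by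
  simp [polarDeriv_apply]

theorem natDegree_polarDeriv_le {n : ℕ} (w : ℂ) {f : ℂ[X]} (hf : f.natDegree ≤ n + 1) :
    (polarDeriv (n + 1) w f).natDegree ≤ n := by
  rw [natDegree_le_iff_coeff_eq_zero]
  intro N hN
  obtain ⟨N, rfl⟩ : ∃ k, N = k + 1 := ⟨N - 1, by omega⟩
  have h1 : f.coeff (N + 1 + 1) = 0 := coeff_eq_zero_of_natDegree_lt (by omega)
  simp only [polarDeriv_apply, coeff_add, coeff_smul, sub_mul, coeff_sub, coeff_C_mul, coeff_X_mul,
    coeff_derivative, h1, smul_eq_mul]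
  rcases Nat.lt_or_ge n N with h | h
  · rw [coeff_eq_zero_of_natDegree_lt (p := f) (n := N + 1) (by omega)]
    simp
  · obtain rfl : N = n := by omega
    have : ((N : ℂ) + 1) ≠ 0 := by exact_mod_cast Nat.succ_ne_zero N
    push_cast
    field_simp
    ring

theorem iterate_derivative_C_sub_X_mul (w : ℂ) (f : ℂ[X]) (j : ℕ) :
    derivative^[j] ((C w - X) * derivative f) =
      (C w - X) * derivative^[j + 1] f - (j : ℂ[X]) * derivative^[j] f := by
  induction j with
  | zero => simp
  | succ j ih =>
    rw [Function.iterate_succ_apply', ih, Function.iterate_succ_apply' _ (j + 1),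
      Function.iterate_succ_apply' _ j]
    simp only [derivative_sub, derivative_mul, derivative_C, derivative_X, derivative_natCast]
    push_cast
    ring

theorem eval_iterate_derivative_polarDeriv {n : ℕ} (hn : n ≠ 0) (w : ℂ) (f : ℂ[X]) (j : ℕ) :
    (derivative^[j] (polarDeriv n w f)).eval w =
      ((n : ℂ) - j) / n * (derivative^[j] f).eval w := by
  have hn' : (n : ℂ) ≠ 0 := by exact_mod_cast hn
  rw [polarDeriv_apply, iterate_map_add, iterate_derivative_smul, iterate_derivative_C_sub_X_mul]
  simp only [eval_add, eval_smul, eval_sub, eval_mul, eval_C, eval_X, sub_self, zero_mul, zero_sub,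
    eval_natCast, smul_eq_mul]
  field_simp
  ring

/-- A point `r` of the closed lower half plane is at least as close to the conjugate of `x` as to
`x`. Inversion turns this into a disk with centre `-i / (2 Im x)` and `0` on its boundary. -/
theorem norm_inv_sub_add_le {x r : ℂ} (hx : 0 < x.im) (hr : r.im ≤ 0) :
    ‖1 / (x - r) + Complex.I / (2 * x.im)‖ ≤ 1 / (2 * x.im) := by
  have hne : x - r ≠ 0 := fun h => by
    have := congrArg Complex.im h
    simp at this
    linarith
  have hx' : (x.im : ℂ) ≠ 0 := by exact_mod_cast hx.ne'
  have e : 1 / (x - r) + Complex.I / (2 * x.im) =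
      (2 * x.im + Complex.I * (x - r)) / ((x - r) * (2 * x.im)) := by
    field_simp
  have hn : ‖(2 * x.im : ℂ)‖ = 2 * x.im := by
    rw [norm_mul, Complex.norm_real, Real.norm_of_nonneg hx.le, Complex.norm_two]
  have key : ‖2 * (x.im : ℂ) + Complex.I * (x - r)‖ ≤ ‖x - r‖ := by
    rw [← sq_le_sq₀ (norm_nonneg _) (norm_nonneg _), ← Complex.normSq_eq_norm_sq,
      ← Complex.normSq_eq_norm_sq, Complex.normSq_apply, Complex.normSq_apply]
    simp
    nlinarith
  rw [e, norm_div, norm_mul, hn, div_le_div_iff₀ (by positivity) (by positivity)]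
  nlinarith [norm_nonneg (x - r)]

/-- Laguerre's theorem for the upper half plane. -/
theorem eval_polarDeriv_ne_zero {n : ℕ} (hn : n ≠ 0) {f : ℂ[X]} (hf : f.natDegree ≤ n)
    (h : ∀ x : ℂ, 0 < x.im → f.eval x ≠ 0) {w x : ℂ} (hw : 0 < w.im) (hx : 0 < x.im) :
    (polarDeriv n w f).eval x ≠ 0 := by
  have hfx := h x hx
  have hx' : (x.im : ℂ) ≠ 0 := by exact_mod_cast hx.ne'
  have hn' : (n : ℂ) ≠ 0 := by exact_mod_cast hn
  have hd := (IsAlgClosed.splits f).eval_derivative_div_eval_of_ne_zero hfx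
  set S := (f.roots.map fun z => 1 / (x - z)).sum with hS
  have hbound : ∀ s : Multiset ℂ, (∀ z ∈ s, z.im ≤ 0) →
      ‖(s.map fun z => 1 / (x - z)).sum + s.card * (Complex.I / (2 * x.im))‖ ≤
        s.card * (1 / (2 * x.im)) := by
    intro s
    induction s using Multiset.induction with
    | empty => simp
    | cons a s ih =>
      intro hs
      have h1 := ih fun z hz => hs z (Multiset.mem_cons_of_mem hz)
      have h2 := norm_inv_sub_add_le hx (hs a (Multiset.mem_cons_self a s))
      rw [Multiset.map_cons, Multiset.sum_cons, Multiset.card_cons]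
      push_cast
      calc _ = ‖(1 / (x - a) + Complex.I / (2 * x.im)) + ((s.map fun z => 1 / (x - z)).sum +
              s.card * (Complex.I / (2 * x.im)))‖ := by congr 1; ring
        _ ≤ _ := (norm_add_le _ _).trans (by linarith)
  have hb := hbound f.roots fun z hz => by
    by_contra! hz'
    exact h z hz' ((mem_roots'.1 hz).2)
  rw [← hS] at hb
  have hI : ‖Complex.I / (2 * x.im)‖ = 1 / (2 * x.im) := by
    rw [norm_div, norm_mul, Complex.norm_real, Real.norm_of_nonneg hx.le]
    simp
  have hcard : (f.roots.card : ℝ) ≤ n := by exact_mod_cast (card_roots' f).trans hf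
  -- If the degree is below `n`, the missing terms are padded with `0`, which lies on the boundary
  -- of the disk.
  have hb' : ‖S + n * (Complex.I / (2 * x.im))‖ ≤ n * (1 / (2 * x.im)) := by
    calc _ = ‖(S + f.roots.card * (Complex.I / (2 * x.im))) +
            (((n : ℝ) - f.roots.card : ℝ) : ℂ) * (Complex.I / (2 * x.im))‖ := by
          congr 1; push_cast; ring
      _ ≤ f.roots.card * (1 / (2 * x.im)) + ((n : ℝ) - f.roots.card) * (1 / (2 * x.im)) := by
          refine (norm_add_le _ _).trans (add_le_add hb ?_)
          rw [norm_mul, hI, Complex.norm_real, Real.norm_of_nonneg (by linarith)]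
      _ = _ := by ring
  intro h0
  rw [eval_polarDeriv, (div_eq_iff hfx).1 hd] at h0
  have h0' : (n : ℂ) + (w - x) * S = 0 := by
    have : f.eval x * ((n : ℂ) + (w - x) * S) = 0 := by
      field_simp at h0
      linear_combination h0
    exact (mul_eq_zero.1 this).resolve_left hfx
  have e : (w - x) * (S + n * (Complex.I / (2 * x.im))) =
      n / (2 * x.im) * (-(2 * x.im) + Complex.I * (w - x)) := by
    have : (w - x) * S = - n := by linear_combination h0'
    rw [mul_add, this]
    field_simp
  have e2 := congrArg norm e
  rw [norm_mul, norm_mul, norm_div, norm_mul 2 (x.im : ℂ), Complex.norm_real,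
    Real.norm_of_nonneg hx.le, Complex.norm_natCast, Complex.norm_two] at e2
  have hn0 : (0 : ℝ) < n := by exact_mod_cast Nat.pos_of_ne_zero hn
  -- The right side is the distance from `w` to the conjugate of `x`, so this is strict because `w`
  -- and `x` both lie above the real axis.
  have key : ‖w - x‖ < ‖-(2 * (x.im : ℂ)) + Complex.I * (w - x)‖ := by
    rw [← sq_lt_sq₀ (norm_nonneg _) (norm_nonneg _), ← Complex.normSq_eq_norm_sq,
      ← Complex.normSq_eq_norm_sq, Complex.normSq_apply, Complex.normSq_apply]
    simp
    nlinarith [mul_pos hw hx]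
  have h3 : ‖w - x‖ * ‖S + n * (Complex.I / (2 * x.im))‖ ≤ ‖w - x‖ * (n * (1 / (2 * x.im))) :=
    mul_le_mul_of_nonneg_left hb' (norm_nonneg _)
  have h4 : (n : ℝ) / (2 * x.im) * ‖w - x‖ <
      n / (2 * x.im) * ‖-(2 * (x.im : ℂ)) + Complex.I * (w - x)‖ :=
    mul_lt_mul_of_pos_left key (by positivity)
  rw [← e2] at h4
  have : ‖w - x‖ * (n * (1 / (2 * x.im))) = (n : ℝ) / (2 * x.im) * ‖w - x‖ := by ring
  linarith

/-- `∑ t, u t (x) * v t (y)` has no zero with `x` and `y` in the open upper half plane. -/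
def StablePair {ι : Type} [Fintype ι] (u v : ι → ℂ[X]) : Prop :=
  ∀ x y : ℂ, 0 < x.im → 0 < y.im → ∑ t, (u t).eval x * (v t).eval y ≠ 0

namespace StablePair

variable {ι : Type} [Fintype ι] {u v : ι → ℂ[X]}

theorem symm (h : StablePair u v) : StablePair v u := fun x y hx hy => by
  simpa only [mul_comm] using h y x hy hx

theorem polarDeriv_left (h : StablePair u v) {n : ℕ} (hn : n ≠ 0) (hu : ∀ t, (u t).natDegree ≤ n)
    {w : ℂ} (hw : 0 < w.im) : StablePair (fun t => polarDeriv n w (u t)) v := by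
  intro x y hx hy
  have key := eval_polarDeriv_ne_zero hn (f := ∑ t, (v t).eval y • u t)
    (natDegree_sum_le_of_forall_le _ _ fun t _ => (natDegree_smul_le _ _).trans (hu t))
    (fun x hx => by
      simpa [eval_finsetSum, mul_comm] using h x y hx hy) hw hx
  simpa [eval_finsetSum, map_sum, map_smul, mul_comm] using key

end StablePair

/-! ### Subtracting mixed derivatives, one root at a time -/

theorem im_nonneg_of_bilinear_ne_zero {u v τ : ℂ}
    (h : ∀ w z : ℂ, 0 < w.im → 0 < z.im → (w + u) * (z + v) ≠ τ) : 0 ≤ u.im := by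
  by_contra! hu
  set K : ℝ := max (v.im + 1) (max 1 (‖τ‖ / (-u.im) + 1)) with hK
  have h1 : v.im + 1 ≤ K := le_max_left _ _
  have h2 : 1 ≤ K := (le_max_left _ _).trans (le_max_right _ _)
  have h3 : ‖τ‖ / (-u.im) + 1 ≤ K := (le_max_right _ _).trans (le_max_right _ _)
  have hK0 : (K : ℂ) ≠ 0 := by
    have : K ≠ 0 := by linarith
    exact_mod_cast this
  -- The witnesses satisfy `z + v = iK` and `w + u = τ / (iK)`. For large `K`, `w` is close to `-u`,
  -- so both are in the upper half plane.
  refine h (-u - Complex.I * τ * ((K⁻¹ : ℝ) : ℂ)) (-v + Complex.I * K) ?_ ?_ ?_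
  · have h4 : ‖τ‖ < K * (-u.im) := by
      rw [← div_lt_iff₀ (by linarith)]
      linarith
    have h5 := Complex.abs_re_le_norm τ
    have h6 : (-u - Complex.I * τ * ((K⁻¹ : ℝ) : ℂ)).im = -u.im - τ.re * K⁻¹ := by
      rw [Complex.sub_im, Complex.im_mul_ofReal]
      simp
    rw [h6, ← div_eq_mul_inv, sub_pos, div_lt_iff₀ (by linarith)]
    linarith [le_abs_self τ.re]
  · simp
    linarith
  · push_cast
    field_simp
    ring_nf
    simp

/-- Subtracting a nonnegative multiple of its mixed derivative keeps a polynomial of degree one in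
each of two variables free of zeros in the product of upper half planes. -/
theorem bilinear_sub_ne_zero {α β γ δ : ℂ}
    (h : ∀ w z : ℂ, 0 < w.im → 0 < z.im → α + β * w + γ * z + δ * (w * z) ≠ 0) {s : ℝ}
    (hs : 0 ≤ s) {w z : ℂ} (hw : 0 < w.im) (hz : 0 < z.im) :
    α + β * w + γ * z + δ * (w * z) - s * δ ≠ 0 := by
  by_cases hδ : δ = 0
  · simpa [hδ] using h w z hw hz
  intro h0
  have hu : 0 ≤ (γ / δ).im := by
    apply im_nonneg_of_bilinear_ne_zero (v := β / δ) (τ := γ / δ * (β / δ) - α / δ)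
    intro w z hw hz h1
    apply h w z hw hz
    field_simp at h1
    apply mul_left_cancel₀ hδ
    linear_combination h1
  have hpos : 0 < (w + γ / δ).im := by
    rw [Complex.add_im]
    linarith
  have hne : w + γ / δ ≠ 0 := fun h => by simp [h] at hpos
  -- Since `z` has coefficient `δ * (w + γ / δ)`, subtracting `s * δ` amounts to this shift of `z`,
  -- which does not lower its imaginary part.
  refine h w (z - s / (w + γ / δ)) hw ?_ ?_
  · have : (s / (w + γ / δ) : ℂ).im ≤ 0 := by
      rw [Complex.div_im]
      simp only [Complex.ofReal_im, Complex.ofReal_re, zero_mul, zero_div, zero_sub]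
      have : 0 ≤ s * (w + γ / δ).im / Complex.normSq (w + γ / δ) :=
        div_nonneg (mul_nonneg hs hpos.le) (Complex.normSq_nonneg _)
      linarith
    rw [Complex.sub_im]
    linarith
  · have e : (δ * w + γ) * (s / (w + γ / δ)) = s * δ := by
      have : δ * w + γ ≠ 0 := by
        intro h
        apply hne
        field_simp
        linear_combination h
      have h2 : w + γ / δ = (δ * w + γ) / δ := by field_simp
      rw [h2]
      field_simp
    linear_combination h0 - e

/-- For fixed `x` and `y` the twice polarized sum is affine in each pole, and the coefficient of `w
* z` is the sum of `u' v'` divided by `a * b`. The second copy of `ι` carries the subtracted term.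
-/
theorem StablePair.mixed {ι : Type} [Fintype ι] {u v : ι → ℂ[X]} (h : StablePair u v) {a b : ℕ}
    (ha : a ≠ 0) (hb : b ≠ 0) (hu : ∀ t, (u t).natDegree ≤ a) (hv : ∀ t, (v t).natDegree ≤ b)
    {s : ℝ} (hs : 0 ≤ s) {w z : ℂ} (hw : 0 < w.im) (hz : 0 < z.im) :
    StablePair (ι := ι ⊕ ι) (Sum.elim (fun t => polarDeriv a w (u t)) fun t => derivative (u t))
      (Sum.elim (fun t => polarDeriv b z (v t))
        fun t => C (-(s * (a : ℂ)⁻¹ * (b : ℂ)⁻¹)) * derivative (v t)) := by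
  intro x y hx hy
  set U := fun t => (u t).eval x + (a : ℂ)⁻¹ * (-x * (derivative (u t)).eval x)
  set V := fun t => (v t).eval y + (b : ℂ)⁻¹ * (-y * (derivative (v t)).eval y)
  set U' := fun t => (a : ℂ)⁻¹ * (derivative (u t)).eval x
  set V' := fun t => (b : ℂ)⁻¹ * (derivative (v t)).eval y
  have hU : ∀ w t, (polarDeriv a w (u t)).eval x = U t + U' t * w := fun w t => by
    rw [eval_polarDeriv]; ring
  have hV : ∀ z t, (polarDeriv b z (v t)).eval y = V t + V' t * z := fun z t => by
    rw [eval_polarDeriv]; ring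
  have hexp : ∀ w z, ∑ t, (polarDeriv a w (u t)).eval x * (polarDeriv b z (v t)).eval y =
      ∑ t, U t * V t + (∑ t, U' t * V t) * w + (∑ t, U t * V' t) * z +
        (∑ t, U' t * V' t) * (w * z) := fun w z => by
    simp only [Finset.sum_mul, ← Finset.sum_add_distrib]
    exact Finset.sum_congr rfl fun t _ => by rw [hU, hV]; ring
  have key := bilinear_sub_ne_zero (fun w z hw hz => by
    rw [← hexp]
    exact ((h.polarDeriv_left ha hu hw).symm.polarDeriv_left hb hv hz).symm x y hx hy) hs hw hz
  rw [← hexp, sub_eq_add_neg] at key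
  have e : ∑ t, (derivative (u t)).eval x *
      (C (-(s * (a : ℂ)⁻¹ * (b : ℂ)⁻¹)) * derivative (v t)).eval y = -s * ∑ t, U' t * V' t := by
    rw [Finset.mul_sum]
    refine Finset.sum_congr rfl fun t _ => ?_
    simp only [eval_mul, eval_C, U', V']
    ring
  rw [Fintype.sum_sum_type]
  simp only [Sum.elim_inl, Sum.elim_inr]
  rwa [e, neg_mul]

/-- The polynomial `∏ (1 - s X)` over the entries `s` of a list. -/
noncomputable def revProd (l : List ℝ) : ℝ[X] := (l.map fun s => 1 - C s * X).prod

theorem natDegree_revProd_le (l : List ℝ) : (revProd l).natDegree ≤ l.length := by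
  induction l with
  | nil => simp [revProd]
  | cons s l ih =>
    have h : (1 - C s * X : ℝ[X]).natDegree ≤ 1 := by compute_degree
    rw [revProd, List.map_cons, List.prod_cons, List.length_cons, add_comm]
    exact natDegree_mul_le.trans (add_le_add h ih)

/-- Induction on the roots: each one uses up a formal degree in both variables through
`StablePair.mixed`. The factorial weights collect the factors `(n - j) / n` that polar derivatives
leave on `j`-th derivatives at their pole. -/
theorem StablePair.revProd_ne_zero (l : List ℝ) (hl : ∀ s ∈ l, 0 ≤ s) {w z : ℂ} (hw : 0 < w.im)
    (hz : 0 < z.im) : ∀ {a : ℕ} (_ : l.length ≤ a) {ι : Type} [Fintype ι] {u v : ι → ℂ[X]}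
    (_ : ∀ t, (u t).natDegree ≤ a) (_ : ∀ t, (v t).natDegree ≤ l.length) (_ : StablePair u v),
    ∑ j ∈ Finset.range (l.length + 1), ((revProd l).coeff j : ℂ) *
      (((a - j).factorial * (l.length - j).factorial : ℂ) / (a.factorial * l.length.factorial)) *
      ∑ t, (derivative^[j] (u t)).eval w * (derivative^[j] (v t)).eval z ≠ 0 := by
  induction l with
  | nil =>
    intro a _ ι _ u v _ _ h
    have : (a.factorial : ℂ) ≠ 0 := by exact_mod_cast a.factorial_ne_zero
    simpa [revProd, this] using h w z hw hz
  | cons s l ih =>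
    intro a ha ι _ u v hu hv h
    obtain ⟨a, rfl⟩ : ∃ k, a = k + 1 := ⟨a - 1, by simp at ha; omega⟩
    rw [List.length_cons] at ha hv
    have ha' : l.length ≤ a := by omega
    have hst := h.mixed a.succ_ne_zero l.length.succ_ne_zero hu hv (hl s List.mem_cons_self) hw hz
    have key := ih (fun s hs => hl s (List.mem_cons_of_mem _ hs)) ha' (a := a) (by
      rintro (t | t)
      · exact natDegree_polarDeriv_le w (hu t)
      · exact (natDegree_derivative_le _).trans (Nat.sub_le_of_le_add (hu t))) (by
      rintro (t | t)
      · exact natDegree_polarDeriv_le z (hv t)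
      · exact (natDegree_C_mul_le _ _).trans
          ((natDegree_derivative_le _).trans (Nat.sub_le_of_le_add (hv t)))) hst
    set E : ℕ → ℂ := fun j => ∑ t, (derivative^[j] (u t)).eval w * (derivative^[j] (v t)).eval z
      with hE
    set b := l.length with hb
    have hr : revProd (s :: l) = revProd l - C s * (X * revProd l) := by
      simp only [revProd, List.map_cons, List.prod_cons]
      ring
    have hrb : (revProd l).coeff (b + 1) = 0 :=
      coeff_eq_zero_of_natDegree_lt (Nat.lt_succ_of_le (natDegree_revProd_le l))
    -- Multiplication of the generating polynomial by `1 - s X`, transposed onto the sequence `c`.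
    have hsum : ∀ c : ℕ → ℂ, ∑ j ∈ Finset.range (b + 1 + 1), ((revProd (s :: l)).coeff j : ℂ) * c j =
        ∑ j ∈ Finset.range (b + 1), ((revProd l).coeff j : ℂ) * (c j - s * c (j + 1)) := by
      intro c
      have h1 : ∀ j, ((revProd (s :: l)).coeff j : ℂ) * c j = ((revProd l).coeff j : ℂ) * c j -
          s * (((X * revProd l).coeff j : ℝ) : ℂ) * c j := fun j => by
        rw [hr, coeff_sub, coeff_C_mul]
        push_cast
        ring
      rw [Finset.sum_congr rfl fun j _ => h1 j, Finset.sum_sub_distrib, Finset.sum_range_succ, hrb,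
        Finset.sum_range_succ' (fun j => (s : ℂ) * (((X * revProd l : ℝ[X]).coeff j : ℝ) : ℂ) * c j)
          (b + 1)]
      simp only [coeff_X_mul, coeff_X_mul_zero, Complex.ofReal_zero, zero_mul, mul_zero, add_zero]
      rw [← Finset.sum_sub_distrib]
      exact Finset.sum_congr rfl fun j _ => by ring
    rw [List.length_cons, ← hb]
    simp only [mul_assoc]
    rw [hsum]
    convert key using 1
    refine Finset.sum_congr rfl fun j hj => ?_
    have hj' : j ≤ b := Nat.lt_succ_iff.1 (Finset.mem_range.1 hj)
    rw [Fintype.sum_sum_type]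
    simp only [Sum.elim_inl, Sum.elim_inr, iterate_derivative_C_mul, eval_mul, eval_C,
      eval_iterate_derivative_polarDeriv a.succ_ne_zero,
      eval_iterate_derivative_polarDeriv b.succ_ne_zero, ← Function.iterate_succ_apply]
    have e1 : ∑ t, ((((a + 1 : ℕ) : ℂ) - j) / ((a + 1 : ℕ) : ℂ) * (derivative^[j] (u t)).eval w) *
        ((((b + 1 : ℕ) : ℂ) - j) / ((b + 1 : ℕ) : ℂ) * (derivative^[j] (v t)).eval z) =
        ((a + 1 : ℕ) - j) / ((a + 1 : ℕ) : ℂ) * (((b + 1 : ℕ) - j) / ((b + 1 : ℕ) : ℂ)) * E j := by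
      rw [hE, Finset.mul_sum]
      exact Finset.sum_congr rfl fun t _ => by ring
    have e2 : ∑ t, (derivative^[j + 1] (u t)).eval w *
        (-(s * ((a + 1 : ℕ) : ℂ)⁻¹ * ((b + 1 : ℕ) : ℂ)⁻¹) * (derivative^[j + 1] (v t)).eval z) =
        -(s * ((a + 1 : ℕ) : ℂ)⁻¹ * ((b + 1 : ℕ) : ℂ)⁻¹) * E (j + 1) := by
      rw [hE, Finset.mul_sum]
      exact Finset.sum_congr rfl fun t _ => by ring
    rw [e1, e2]
    have fa : ((a + 1 - j).factorial : ℂ) = ((a + 1 : ℕ) - j) * (a - j).factorial := by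
      rw [Nat.succ_sub (by omega), Nat.factorial_succ]
      push_cast [Nat.cast_sub (show j ≤ a by omega)]
      ring
    have fb : ((b + 1 - j).factorial : ℂ) = ((b + 1 : ℕ) - j) * (b - j).factorial := by
      rw [Nat.succ_sub (by omega), Nat.factorial_succ]
      push_cast [Nat.cast_sub hj']
      ring
    have hE1 : ∑ t, (derivative^[j] (u t)).eval w * (derivative^[j] (v t)).eval z = E j := rfl
    have hE2 : ∑ t, (derivative^[j + 1] (u t)).eval w * (derivative^[j + 1] (v t)).eval z =
      E (j + 1) := rfl
    rw [hE1, hE2, Nat.add_sub_add_right, Nat.add_sub_add_right, fa, fb, Nat.factorial_succ a,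
      Nat.factorial_succ b]
    have n1 : ((a + 1 : ℕ) : ℂ) ≠ 0 := by exact_mod_cast a.succ_ne_zero
    have n2 : ((b + 1 : ℕ) : ℂ) ≠ 0 := by exact_mod_cast b.succ_ne_zero
    have n3 : (a.factorial : ℂ) ≠ 0 := by exact_mod_cast a.factorial_ne_zero
    have n4 : (b.factorial : ℂ) ≠ 0 := by exact_mod_cast b.factorial_ne_zero
    simp only [Nat.cast_mul]
    field_simp
    ring

/-! ### The coefficient formula and its real-rootedness -/

/-- The rectangular additive convolution of two polynomials of degree `d`, in terms of their
coefficients. -/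
noncomputable def rectForm (m d : ℕ) (p q : ℝ[X]) : ℝ[X] :=
  ∑ i ∈ Finset.range (d + 1), ∑ j ∈ Finset.range (d + 1),
    C (p.coeff (d - i) * q.coeff (d - j) *
      (((m - i).choose j * (d - i).choose j : ℝ) / (m.choose j * d.choose j))) * X ^ (d - i - j)

theorem natDegree_rectForm_le (m d : ℕ) (p q : ℝ[X]) : (rectForm m d p q).natDegree ≤ d :=
  natDegree_sum_le_of_forall_le _ _ fun i _ => natDegree_sum_le_of_forall_le _ _ fun j _ =>
    (natDegree_C_mul_X_pow_le _ _).trans (by omega)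

theorem coeff_rectForm_self (m d : ℕ) (p q : ℝ[X]) :
    (rectForm m d p q).coeff d = p.coeff d * q.coeff d := by
  simp only [rectForm, finsetSum_coeff, coeff_C_mul, coeff_X_pow]
  rw [Finset.sum_eq_single_of_mem 0 (by simp), Finset.sum_eq_single_of_mem 0 (by simp)]
  · simp
  · intro j hj hj0
    rw [Finset.mem_range] at hj
    rw [if_neg (by omega), mul_zero]
  · intro i hi hi0
    rw [Finset.mem_range] at hi
    exact Finset.sum_eq_zero fun j _ => by rw [if_neg (by omega), mul_zero]

theorem coeff_rectForm_pred {m d : ℕ} (hd : 0 < d) (hdm : d ≤ m) (p q : ℝ[X]) :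
    (rectForm m d p q).coeff (d - 1) =
      p.coeff (d - 1) * q.coeff d + p.coeff d * q.coeff (d - 1) := by
  obtain ⟨d, rfl⟩ : ∃ k, d = k + 1 := ⟨d - 1, by omega⟩
  have hm : (m : ℝ) ≠ 0 := by
    have : m ≠ 0 := by omega
    exact_mod_cast this
  have hd' : ((d : ℝ) + 1) ≠ 0 := by exact_mod_cast d.succ_ne_zero
  simp only [rectForm, finsetSum_coeff, coeff_C_mul, coeff_X_pow]
  have h0 : ∀ i ∈ Finset.range d, ∀ j ∈ Finset.range (d + 1 + 1),
      p.coeff (d + 1 - (i + 1 + 1)) * q.coeff (d + 1 - j) *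
        (((m - (i + 1 + 1)).choose j * (d + 1 - (i + 1 + 1)).choose j : ℝ) /
        (m.choose j * (d + 1).choose j)) *
        (if d + 1 - 1 = d + 1 - (i + 1 + 1) - j then 1 else 0 : ℝ) = 0 := by
    intro i hi j _
    rw [Finset.mem_range] at hi
    rw [if_neg (by omega), mul_zero]
  rw [Finset.sum_range_succ', Finset.sum_range_succ',
    Finset.sum_eq_zero fun i hi => Finset.sum_eq_zero (h0 i hi), zero_add]
  have h1 : ∀ j ∈ Finset.range (d + 1 + 1), j ≠ 0 →
      p.coeff (d + 1 - (0 + 1)) * q.coeff (d + 1 - j) *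
        (((m - (0 + 1)).choose j * (d + 1 - (0 + 1)).choose j : ℝ) /
        (m.choose j * (d + 1).choose j)) *
        (if d + 1 - 1 = d + 1 - (0 + 1) - j then 1 else 0 : ℝ) = 0 := by
    intro j _ hj0
    -- In original degree one, truncated subtraction sends the `(1, 1)` term to the same exponent;
    -- its binomial coefficient vanishes.
    rcases Nat.eq_zero_or_pos d with rfl | hd
    · rw [Nat.choose_eq_zero_of_lt (show 0 + 1 - (0 + 1) < j by omega)]
      simp
    · rw [if_neg (by omega), mul_zero]
  rw [Finset.sum_eq_single_of_mem 0 (by simp) h1, Finset.sum_eq_single_of_mem 1 (by simp)]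
  · simp
    field_simp
  · intro j hj hj1
    rw [Finset.mem_range] at hj
    rw [if_neg (by omega), mul_zero]

theorem reverse_prod_X_sub_C (l : List ℝ) :
    ((l.map fun s => X - C s).prod).reverse = revProd l := by
  induction l with
  | nil => simpa [revProd] using reverse_C (1 : ℝ)
  | cons s l ih =>
    have h : (X - C s).reverse = 1 - C s * X := by
      have h1 : (X - C s : ℝ[X]) = C 1 * X + C (-s) := by simp [sub_eq_add_neg]
      ext n
      rw [coeff_reverse, natDegree_X_sub_C]
      rcases n with _ | _ | n
      · simp
      · simp [coeff_one]
      · rw [revAt_eq_self_of_lt (by omega)]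
        simp [coeff_X, coeff_one]
    rw [List.map_cons, List.prod_cons, reverse_mul_of_domain, ih, h, revProd, revProd,
      List.map_cons, List.prod_cons]

namespace IsNonnegRooted

variable {d m : ℕ} {p q : ℝ[X]}

theorem eq_prod (hp : IsNonnegRooted d p) : p = (p.roots.toList.map fun s => X - C s).prod := by
  conv_lhs => rw [hp.splits.eq_prod_roots_of_monic hp.monic]
  rw [← Multiset.prod_coe, ← Multiset.map_coe, Multiset.coe_toList]

theorem card_roots (hp : IsNonnegRooted d p) : p.roots.card = d :=
  hp.splits.natDegree_eq_card_roots.symm.trans hp.natDegree_eq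

theorem coeff_sub_eq (hp : IsNonnegRooted d p) {j : ℕ} (hj : j ≤ d) :
    p.coeff (d - j) = (revProd p.roots.toList).coeff j := by
  rw [← reverse_prod_X_sub_C, ← hp.eq_prod, coeff_reverse, hp.natDegree_eq, revAt_le hj]

theorem eval_ne_zero (hp : IsNonnegRooted d p) {w z : ℂ} (hw : 0 < w.im) (hz : 0 < z.im) :
    (p.map Complex.ofRealHom).eval (w * z) ≠ 0 := by
  rw [(hp.splits.map _).eval_eq_prod_roots_of_monic (hp.monic.map _), hp.splits.roots_map,
    Multiset.map_map]
  intro h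
  obtain ⟨r, hr, h⟩ := Multiset.mem_map.1 (Multiset.prod_eq_zero_iff.1 h)
  have hr0 := hp.nonneg_of_mem_roots r hr
  simp only [Function.comp_apply, Complex.ofRealHom_eq_coe, sub_eq_zero] at h
  have h1 := congrArg Complex.re h
  have h2 := congrArg Complex.im h
  simp only [Complex.mul_re, Complex.mul_im, Complex.ofReal_re, Complex.ofReal_im] at h1 h2
  -- Together with `h4` this gives `|w|² Im z = -r Im w`, the imaginary part of `conj w * (w z)`,
  -- whose two sides have opposite signs.
  have h3 : w.re * (w.re * z.im + w.im * z.re) = 0 := by rw [h2, mul_zero]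
  have h4 : w.im * (w.re * z.re - w.im * z.im) = w.im * r := by rw [h1]
  nlinarith [mul_nonneg hw.le hr0, mul_pos (mul_pos hw hw) hz, mul_nonneg (mul_self_nonneg w.re) hz.le]

/-- The pair `u`, `v` encodes `x ^ (m - d) * p (x y)`. The extra power gives `x` formal degree `m`,
which produces the binomials in `m`; the roots of `q` are then fed to `StablePair.revProd_ne_zero`.
-/
theorem eval_rectForm_ne_zero (hdm : d ≤ m) (hp : IsNonnegRooted d p) (hq : IsNonnegRooted d q)
    {w z : ℂ} (hw : 0 < w.im) (hz : 0 < z.im) :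
    ((rectForm m d p q).map Complex.ofRealHom).eval (w * z) ≠ 0 := by
  have hlen : q.roots.toList.length = d := by rw [Multiset.length_toList, hq.card_roots]
  set u : Fin (d + 1) → ℂ[X] := fun i => C (p.coeff (d - i) : ℂ) * X ^ (m - i : ℕ) with hu
  set v : Fin (d + 1) → ℂ[X] := fun i => X ^ (d - i : ℕ) with hv
  have hst : StablePair u v := by
    intro x y hx hy
    have hx0 : x ≠ 0 := fun h => by simp [h] at hx
    have h := mul_ne_zero (pow_ne_zero (m - d) hx0) (hp.eval_ne_zero hx hy)
    convert h using 1
    rw [eval_eq_sum_range, natDegree_map, hp.natDegree_eq, Finset.mul_sum,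
      ← Finset.sum_range_reflect, Finset.sum_range]
    refine Finset.sum_congr rfl fun i _ => ?_
    have hi : (i : ℕ) ≤ d := Nat.lt_succ_iff.1 i.2
    have e1 : d + 1 - 1 - (i : ℕ) = d - i := by omega
    have e2 : m - (i : ℕ) = (m - d) + (d - i) := by omega
    simp only [hu, hv, eval_mul, eval_C, eval_pow, eval_X, coeff_map, Complex.ofRealHom_eq_coe, e1,
      e2, mul_pow, pow_add]
    ring
  have key := hst.revProd_ne_zero q.roots.toList
    (fun s hs => hq.nonneg_of_mem_roots s (Multiset.mem_toList.1 hs)) hw hz (a := m)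
    (by rwa [hlen])
    (fun t => (natDegree_C_mul_X_pow_le _ _).trans (by omega))
    (fun t => (natDegree_X_pow_le _).trans (by omega))
  rw [hlen] at key
  intro h0
  apply key
  rw [← mul_zero (w ^ (m - d)), ← h0, rectForm, Finset.sum_comm]
  simp only [Polynomial.map_sum, eval_finsetSum, Polynomial.map_mul, map_C, Polynomial.map_pow,
    map_X, eval_mul, eval_C, eval_pow, eval_X, Finset.mul_sum]
  refine Finset.sum_congr rfl fun j hj => ?_
  have hj' : j ≤ d := Nat.lt_succ_iff.1 (Finset.mem_range.1 hj)
  rw [Finset.sum_range]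
  refine Finset.sum_congr rfl fun i _ => ?_
  have hi : (i : ℕ) ≤ d := Nat.lt_succ_iff.1 i.2
  have f1 : ((m.choose j : ℕ) : ℂ) * (j.factorial * (m - j).factorial) = m.factorial := by
    rw [← mul_assoc]; exact_mod_cast Nat.choose_mul_factorial_mul_factorial (hj'.trans hdm)
  have f2 : ((d.choose j : ℕ) : ℂ) * (j.factorial * (d - j).factorial) = d.factorial := by
    rw [← mul_assoc]; exact_mod_cast Nat.choose_mul_factorial_mul_factorial hj'
  have g : ∀ n : ℕ, (n.descFactorial j : ℂ) = j.factorial * n.choose j := fun n => by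
    exact_mod_cast Nat.descFactorial_eq_factorial_mul_choose n j
  have c1 : ((m.choose j : ℕ) : ℂ) ≠ 0 := by exact_mod_cast (Nat.choose_pos (hj'.trans hdm)).ne'
  have c2 : ((d.choose j : ℕ) : ℂ) ≠ 0 := by exact_mod_cast (Nat.choose_pos hj').ne'
  have c3 : (j.factorial : ℂ) ≠ 0 := by exact_mod_cast j.factorial_ne_zero
  have c4 : ((m - j).factorial : ℂ) ≠ 0 := by exact_mod_cast (m - j).factorial_ne_zero
  have c5 : ((d - j).factorial : ℂ) ≠ 0 := by exact_mod_cast (d - j).factorial_ne_zero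
  simp only [iterate_derivative_C_mul, iterate_derivative_X_pow_eq_natCast_mul, eval_mul,
    eval_C, eval_pow, eval_X, eval_natCast, g, ← f1, ← f2, hq.coeff_sub_eq hj',
    Complex.ofRealHom_eq_coe]
  push_cast
  -- For `i + j > d` the truncated exponents need not agree, but the binomial factor is zero.
  by_cases hij : (i : ℕ) + j ≤ d
  · have e : m - (i : ℕ) - j = (m - d) + (d - i - j) := by omega
    rw [e, pow_add, mul_pow]
    field_simp
  · rw [Nat.choose_eq_zero_of_lt (show d - (i : ℕ) < j by omega)]
    simp

theorem rectForm (hdm : d ≤ m) (hp : IsNonnegRooted d p) (hq : IsNonnegRooted d q) :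
    IsNonnegRooted d (rectForm m d p q) := by
  have hone : (_root_.rectForm m d p q).coeff d = 1 := by
    have h1 := hp.monic.coeff_natDegree
    have h2 := hq.monic.coeff_natDegree
    rw [hp.natDegree_eq] at h1
    rw [hq.natDegree_eq] at h2
    rw [coeff_rectForm_self, h1, h2, one_mul]
  have hmon : (_root_.rectForm m d p q).Monic :=
    monic_of_natDegree_le_of_coeff_eq_one d (natDegree_rectForm_le m d p q) hone
  have hroot : ∀ ζ : ℂ, ((_root_.rectForm m d p q).map Complex.ofRealHom).eval ζ = 0 →
      ∃ r : ℝ, 0 ≤ r ∧ (r : ℂ) = ζ := by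
    intro ζ hζ
    -- If a square root of `ζ` is not real, it or its negative lies in the upper half plane, and `ζ`
    -- is the product of that number with itself.
    obtain ⟨w, rfl⟩ := IsAlgClosed.exists_pow_nat_eq ζ (n := 2) two_pos
    rcases lt_trichotomy w.im 0 with h | h | h
    · refine absurd ?_ (eval_rectForm_ne_zero hdm hp hq (w := -w) (z := -w) (by simpa) (by simpa))
      rwa [neg_mul_neg, ← sq]
    · refine ⟨w.re ^ 2, sq_nonneg _, ?_⟩
      rw [Complex.ofReal_pow]
      congr 1
      exact Complex.ext (by simp) (by simp [h])
    · refine absurd ?_ (eval_rectForm_ne_zero hdm hp hq h h)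
      rwa [← sq]
  refine ⟨hmon, ?_, ?_, ?_⟩
  · exact le_antisymm (natDegree_rectForm_le m d p q)
      (le_natDegree_of_ne_zero (by rw [hone]; exact one_ne_zero))
  · refine Splits.of_splits_map Complex.ofRealHom (IsAlgClosed.splits _) fun a ha => ?_
    obtain ⟨r, _, hr⟩ := hroot a (mem_roots'.1 ha).2
    exact ⟨r, hr⟩
  · intro x hx
    obtain ⟨r, hr, hrx⟩ := hroot x (by
      have : (_root_.rectForm m d p q).eval x = 0 := (mem_roots'.1 hx).2
      have h := eval_map_apply Complex.ofRealHom x (p := _root_.rectForm m d p q)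
      rw [this, map_zero] at h
      exact h)
    rwa [← Complex.ofReal_injective hrx]

end IsNonnegRooted

/-! ### Expansions in principal minors -/

namespace Matrix

section RowMix

variable {n : Type*} [DecidableEq n]

/-- The matrix with the rows of `X` in `S` and the rows of `Y` outside `S`. -/
def rowMix (S : Finset n) (X Y : Matrix n n ℝ) : Matrix n n ℝ :=
  of fun i j => if i ∈ S then X i j else Y i j

theorem rowMix_apply (S : Finset n) (X Y : Matrix n n ℝ) (i j : n) :
    rowMix S X Y i j = if i ∈ S then X i j else Y i j := rfl

variable [Fintype n]

/-- The principal minor of `X` on `S`. -/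
def principalMinor (S : Finset n) (X : Matrix n n ℝ) : ℝ := (rowMix S X 1).det

theorem det_add_eq_sum_rowMix (X Y : Matrix n n ℝ) :
    (X + Y).det = ∑ S : Finset n, (rowMix S X Y).det := by
  have h := (detRowAlternating (n := n) (R := ℝ)).map_add_univ X Y
  refine h.trans (Finset.sum_congr rfl fun S _ => ?_)
  change det (S.piecewise X Y) = _
  congr 1
  ext i j
  simp only [rowMix_apply, Finset.piecewise]
  split_ifs <;> rfl

theorem det_rowMix_diagonal (V : Finset n) (M : Matrix n n ℝ) (c : n → ℝ) :
    (rowMix V M (diagonal c)).det = (∏ i ∈ Vᶜ, c i) * principalMinor V M := by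
  have h : rowMix V M (diagonal c) = diagonal (fun i => if i ∈ V then 1 else c i) * rowMix V M 1 := by
    ext i j
    rw [diagonal_mul, rowMix_apply, rowMix_apply]
    by_cases hi : i ∈ V
    · simp [hi]
    · simp [hi, diagonal_apply, one_apply]
  rw [h, det_mul, det_diagonal, principalMinor]
  congr 1
  rw [Finset.prod_ite, Finset.prod_const_one, one_mul]
  exact Finset.prod_congr (by ext; simp) fun _ _ => rfl

theorem det_diagonal_add (c : n → ℝ) (M : Matrix n n ℝ) :
    (diagonal c + M).det = ∑ V : Finset n, (∏ i ∈ Vᶜ, c i) * principalMinor V M := by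
  rw [add_comm, det_add_eq_sum_rowMix]
  exact Finset.sum_congr rfl fun V _ => det_rowMix_diagonal V M c

theorem principalMinor_diagonal_add (S : Finset n) (c : n → ℝ) (M : Matrix n n ℝ) :
    principalMinor S (diagonal c + M) =
      ∑ V ∈ S.powerset, (∏ i ∈ S \ V, c i) * principalMinor V M := by
  -- The second summand has zero rows outside `S`, which kills every `V` not contained in `S`.
  have h : rowMix S (diagonal c + M) 1 =
      diagonal (fun i => if i ∈ S then c i else 1) + rowMix S M 0 := by
    ext i j
    by_cases hi : i ∈ S
    · simp [rowMix_apply, hi, diagonal_apply]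
    · simp [rowMix_apply, hi, diagonal_apply, one_apply]
  rw [principalMinor, h, det_diagonal_add, ← Finset.sum_subset (Finset.subset_univ S.powerset)]
  · refine Finset.sum_congr rfl fun V hV => ?_
    rw [Finset.mem_powerset] at hV
    congr 1
    · rw [Finset.prod_ite, Finset.prod_const_one, mul_one]
      refine Finset.prod_congr ?_ fun _ _ => rfl
      ext
      simp [and_comm]
    · rw [principalMinor, principalMinor]
      congr 1
      ext i j
      by_cases hi : i ∈ V
      · simp [rowMix_apply, hi, hV hi]
      · simp [rowMix_apply, hi]
  · intro V _ hV
    rw [Finset.mem_powerset, Finset.not_subset] at hV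
    obtain ⟨i, hi, hiS⟩ := hV
    rw [principalMinor, det_eq_zero_of_row_eq_zero i, mul_zero]
    intro j
    simp [rowMix_apply, hi, hiS]

/-- Clearing the columns in `S` from the rows of `Y` makes the matrix block triangular. -/
theorem det_rowMix_truncated (S : Finset n) (X Y : Matrix n n ℝ) :
    (rowMix S X (of fun i j => if j ∈ S then 0 else Y i j)).det =
      principalMinor S X * principalMinor Sᶜ Y := by
  rw [principalMinor, principalMinor, twoBlockTriangular_det _ (· ∈ S),
    twoBlockTriangular_det (rowMix S X 1) (· ∈ S), twoBlockTriangular_det' (rowMix Sᶜ Y 1) (· ∈ S)]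
  · have h1 : toSquareBlockProp (rowMix S X (of fun i j => if j ∈ S then 0 else Y i j)) (· ∈ S) =
        toSquareBlockProp (rowMix S X 1) (· ∈ S) := by
      ext ⟨i, hi⟩ ⟨j, hj⟩
      simp [toSquareBlockProp, rowMix_apply, hi]
    have h2 : toSquareBlockProp (rowMix S X (of fun i j => if j ∈ S then 0 else Y i j)) (¬ · ∈ S) =
        toSquareBlockProp (rowMix Sᶜ Y 1) (¬ · ∈ S) := by
      ext ⟨i, hi⟩ ⟨j, hj⟩
      simp [toSquareBlockProp, rowMix_apply, hi, hj]
    have h3 : toSquareBlockProp (rowMix S X 1) (¬ · ∈ S) = 1 := by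
      ext ⟨i, hi⟩ ⟨j, hj⟩
      simp [toSquareBlockProp, rowMix_apply, hi, one_apply]
    have h4 : toSquareBlockProp (rowMix Sᶜ Y 1) (· ∈ S) = 1 := by
      ext ⟨i, hi⟩ ⟨j, hj⟩
      simp [toSquareBlockProp, rowMix_apply, hi, one_apply]
    rw [h1, h2, h3, h4]
    simp
  · intro i hi j hj
    have : i ≠ j := fun h => hj (h ▸ hi)
    simp [rowMix_apply, hi, this]
  · intro i hi j hj
    have : i ≠ j := fun h => hi (h ▸ hj)
    simp [rowMix_apply, hi, this]
  · intro i hi j hj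
    simp [rowMix_apply, hi, hj]

theorem principalMinor_submatrix (S : Finset n) (X : Matrix n n ℝ) (π : Equiv.Perm n) :
    principalMinor S (X.submatrix π π) = principalMinor (S.map π.toEmbedding) X := by
  rw [principalMinor, principalMinor, ← det_submatrix_equiv_self π (rowMix _ X 1)]
  congr 1
  ext i j
  simp [rowMix_apply, one_apply]

theorem principalMinor_diagonal_mul_mul_diagonal (S : Finset n) (X : Matrix n n ℝ) (a b : n → ℝ)
    (hb : ∀ i, b i ≠ 0) :
    principalMinor S (diagonal a * X * diagonal b) =
      (∏ i ∈ S, a i) * (∏ i ∈ S, b i) * principalMinor S X := by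
  -- Outside `S` the row factor `(b i)⁻¹` undoes the column scaling of the identity rows.
  have h : rowMix S (diagonal a * X * diagonal b) 1 =
      diagonal (fun i => if i ∈ S then a i else (b i)⁻¹) * rowMix S X 1 * diagonal b := by
    ext i j
    rw [mul_diagonal, diagonal_mul, rowMix_apply, rowMix_apply, mul_diagonal, diagonal_mul]
    by_cases hi : i ∈ S
    · simp [hi]
    · by_cases hij : i = j
      · subst hij
        simp [hi, hb]
      · simp [hi, hij]
  rw [principalMinor, h, det_mul, det_mul, det_diagonal, det_diagonal, principalMinor,
    ← Finset.prod_mul_prod_compl S b, Finset.prod_ite, Finset.filter_mem_eq_inter,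
    Finset.univ_inter]
  have h2 : (∏ i with i ∉ S, (b i)⁻¹) * ∏ i ∈ Sᶜ, b i = 1 := by
    have : Finset.univ.filter (· ∉ S) = Sᶜ := by ext; simp
    rw [this, ← Finset.prod_mul_distrib]
    exact Finset.prod_eq_one fun i _ => inv_mul_cancel₀ (hb i)
  linear_combination (∏ i ∈ S, a i) * (∏ i ∈ S, b i) * (rowMix S X 1).det * h2

theorem continuous_principalMinor (S : Finset n) :
    Continuous (principalMinor S : Matrix n n ℝ → ℝ) := by
  refine Continuous.matrix_det (continuous_matrix fun i j => ?_)
  simp only [rowMix_apply]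
  split_ifs
  · exact continuous_id.matrix_elem i j
  · exact continuous_const

end RowMix

/-! ### The dilation and the singular characteristic polynomial -/

section Dilation

variable {m d : ℕ}

/-- The symmetric matrix with off-diagonal blocks `C` and `Cᵀ`. -/
def dilation (C : Matrix (Fin m) (Fin d) ℝ) : Matrix (Fin m ⊕ Fin d) (Fin m ⊕ Fin d) ℝ :=
  fromBlocks 0 C C.transpose 0

theorem dilation_add (A C : Matrix (Fin m) (Fin d) ℝ) :
    dilation (A + C) = dilation A + dilation C := by
  simp [dilation, fromBlocks_add]

theorem continuous_dilation :
    Continuous (dilation : Matrix (Fin m) (Fin d) ℝ → _) :=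
  Continuous.matrix_fromBlocks continuous_const continuous_id continuous_id.matrix_transpose
    continuous_const

theorem eval_singCharpoly (C : Matrix (Fin m) (Fin d) ℝ) (y : ℝ) :
    (singCharpoly C).eval y = (diagonal (Sum.elim (fun _ => 1) fun _ => y) + dilation C).det := by
  have h : diagonal (Sum.elim (fun _ : Fin m => (1 : ℝ)) fun _ : Fin d => y) + dilation C =
      fromBlocks 1 C C.transpose (scalar (Fin d) y) := by
    rw [← fromBlocks_diagonal, dilation, fromBlocks_add, diagonal_one]
    simp [scalar_apply]
  rw [h, det_fromBlocks_one₁₁, singCharpoly, eval_charpoly]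

theorem prod_sumElim_const (V : Finset (Fin m ⊕ Fin d)) (x y : ℝ) :
    ∏ i ∈ V, Sum.elim (fun _ => x) (fun _ => y) i = x ^ V.toLeft.card * y ^ V.toRight.card := by
  conv_lhs => rw [← Finset.toLeft_disjSum_toRight (u := V)]
  rw [Finset.prod_sumElim, Finset.prod_const, Finset.prod_const]

theorem card_compl_toRight (V : Finset (Fin m ⊕ Fin d)) :
    Vᶜ.toRight.card = d - V.toRight.card := by
  have : Vᶜ.toRight = V.toRightᶜ := by ext; simp
  rw [this, Finset.card_compl, Fintype.card_fin]

theorem card_compl_toLeft (V : Finset (Fin m ⊕ Fin d)) :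
    Vᶜ.toLeft.card = m - V.toLeft.card := by
  have : Vᶜ.toLeft = V.toLeftᶜ := by ext; simp
  rw [this, Finset.card_compl, Fintype.card_fin]

/-- Scaling left rows by `2` and right columns by `1/2` fixes the dilation but multiplies the minor
by `2` to the power left size minus right size. -/
theorem principalMinor_dilation_eq_zero {V : Finset (Fin m ⊕ Fin d)}
    (hV : V.toLeft.card ≠ V.toRight.card) (C : Matrix (Fin m) (Fin d) ℝ) :
    principalMinor V (dilation C) = 0 := by
  have h : diagonal (Sum.elim (fun _ => 2) fun _ => 1) * dilation C *
      diagonal (Sum.elim (fun _ => 1) fun _ => 2⁻¹) = dilation C := by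
    ext (i | i) (j | j) <;> simp [dilation, mul_diagonal, diagonal_mul]
    ring
  have h2 := principalMinor_diagonal_mul_mul_diagonal V (dilation C)
    (Sum.elim (fun _ => 2) fun _ => 1) (Sum.elim (fun _ => 1) fun _ => 2⁻¹)
    (by rintro (i | i) <;> simp)
  rw [h, prod_sumElim_const, prod_sumElim_const, one_pow, one_pow, mul_one, one_mul] at h2
  by_contra h0
  have h3 : (2 : ℝ) ^ V.toLeft.card * 2⁻¹ ^ V.toRight.card = 1 :=
    mul_right_cancel₀ h0 (by rw [one_mul]; exact h2.symm)
  rw [inv_pow, mul_inv_eq_one₀ (by positivity)] at h3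
  exact hV (Nat.pow_right_injective le_rfl (by exact_mod_cast h3))

theorem singCharpoly_eq_sum (C : Matrix (Fin m) (Fin d) ℝ) :
    singCharpoly C = ∑ V : Finset (Fin m ⊕ Fin d),
      Polynomial.C (principalMinor V (dilation C)) * X ^ (d - V.toRight.card) := by
  refine Polynomial.funext fun y => ?_
  rw [eval_singCharpoly, det_diagonal_add, eval_finsetSum]
  refine Finset.sum_congr rfl fun V _ => ?_
  rw [prod_sumElim_const, card_compl_toRight, one_pow, one_mul, eval_mul, eval_C, eval_pow, eval_X,
    mul_comm]

theorem card_toRight_le (V : Finset (Fin m ⊕ Fin d)) : V.toRight.card ≤ d := by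
  simpa using V.toRight.card_le_univ

theorem coeff_singCharpoly (C : Matrix (Fin m) (Fin d) ℝ) {j : ℕ} (hj : j ≤ d) :
    (singCharpoly C).coeff (d - j) =
      ∑ V : Finset (Fin m ⊕ Fin d) with V.toRight.card = j, principalMinor V (dilation C) := by
  rw [singCharpoly_eq_sum, finsetSum_coeff, Finset.sum_filter]
  refine Finset.sum_congr rfl fun V _ => ?_
  have := card_toRight_le V
  rw [coeff_C_mul, coeff_X_pow]
  by_cases h : V.toRight.card = j
  · simp [h]
  · rw [if_neg (by omega), if_neg h, mul_zero]

theorem natDegree_singCharpoly (C : Matrix (Fin m) (Fin d) ℝ) : (singCharpoly C).natDegree = d := by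
  rw [singCharpoly, charpoly_natDegree_eq_dim, Fintype.card_fin]

theorem continuous_coeff_singCharpoly {k : ℕ} (hk : k ≤ d) :
    Continuous fun C : Matrix (Fin m) (Fin d) ℝ => (singCharpoly C).coeff k := by
  have : ∀ C : Matrix (Fin m) (Fin d) ℝ, (singCharpoly C).coeff k = ∑ V : Finset (Fin m ⊕ Fin d)
      with V.toRight.card = d - k, principalMinor V (dilation C) := fun C => by
    rw [← coeff_singCharpoly C (Nat.sub_le d k), Nat.sub_sub_self hk]
  simp only [this]
  exact continuous_finsetSum _ fun V _ => (continuous_principalMinor V).comp continuous_dilation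

end Dilation

end Matrix

/-! ### Averages over the orthogonal groups -/

instance orthHaar.isProbabilityMeasure (n : ℕ) : IsProbabilityMeasure (orthHaar n) :=
  ⟨by simpa [orthHaar] using Measure.haarMeasure_self (K₀ := (⊤ : TopologicalSpace.PositiveCompacts (OrthGroup n)))⟩

instance orthHaar.isMulLeftInvariant (n : ℕ) : (orthHaar n).IsMulLeftInvariant := by
  unfold orthHaar
  infer_instance

instance OrthGroup.secondCountableTopology (n : ℕ) : SecondCountableTopology (OrthGroup n) :=
  haveI : SecondCountableTopology (Matrix (Fin n) (Fin n) ℝ) :=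
    inferInstanceAs (SecondCountableTopology (Fin n → Fin n → ℝ))
  TopologicalSpace.Subtype.secondCountableTopology
    (Matrix.orthogonalGroup (Fin n) ℝ : Set (Matrix (Fin n) (Fin n) ℝ))

section OrthogonalMean

open Matrix

variable {m d : ℕ}

/-- The mean of `F (Q B Rᵀ)` over independent Haar distributed orthogonal `Q` and `R`. -/
noncomputable def orthMean (B : Matrix (Fin m) (Fin d) ℝ) (F : Matrix (Fin m) (Fin d) ℝ → ℝ) : ℝ :=
  ∫ Q : OrthGroup m, ∫ R : OrthGroup d,
    F ((Q : Matrix (Fin m) (Fin m) ℝ) * B * (R : Matrix (Fin d) (Fin d) ℝ).transpose)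
    ∂(orthHaar d) ∂(orthHaar m)

theorem continuous_orthogonal_conj (B : Matrix (Fin m) (Fin d) ℝ) :
    Continuous fun P : OrthGroup m × OrthGroup d =>
      (P.1 : Matrix (Fin m) (Fin m) ℝ) * B * (P.2 : Matrix (Fin d) (Fin d) ℝ).transpose :=
  ((continuous_subtype_val.comp continuous_fst).matrix_mul continuous_const).matrix_mul
    (continuous_subtype_val.comp continuous_snd).matrix_transpose

theorem integrable_orthHaar {n : ℕ} {f : OrthGroup n → ℝ} (hf : Continuous f) :
    Integrable f (orthHaar n) :=
  hf.integrable_of_hasCompactSupport (HasCompactSupport.of_compactSpace f)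

section orthMean

variable (B : Matrix (Fin m) (Fin d) ℝ) {F : Matrix (Fin m) (Fin d) ℝ → ℝ}

theorem integrable_inner_orthMean (hF : Continuous F) (Q : OrthGroup m) :
    Integrable (fun R : OrthGroup d => F ((Q : Matrix (Fin m) (Fin m) ℝ) * B *
      (R : Matrix (Fin d) (Fin d) ℝ).transpose)) (orthHaar d) :=
  integrable_orthHaar
    ((hF.comp (continuous_orthogonal_conj B)).comp (Continuous.prodMk continuous_const continuous_id))

theorem integrable_outer_orthMean (hF : Continuous F) :
    Integrable (fun Q : OrthGroup m => ∫ R : OrthGroup d, F ((Q : Matrix (Fin m) (Fin m) ℝ) * B *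
      (R : Matrix (Fin d) (Fin d) ℝ).transpose) ∂(orthHaar d)) (orthHaar m) := by
  apply integrable_orthHaar
  have h := continuous_parametric_integral_of_continuous (μ := orthHaar d)
    (f := fun (Q : OrthGroup m) (R : OrthGroup d) => F ((Q : Matrix (Fin m) (Fin m) ℝ) * B *
      (R : Matrix (Fin d) (Fin d) ℝ).transpose)) (hF.comp (continuous_orthogonal_conj B))
    isCompact_univ
  simpa only [Measure.restrict_univ] using h

theorem orthMean_finset_sum {ι : Type*} (s : Finset ι) {F : ι → Matrix (Fin m) (Fin d) ℝ → ℝ}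
    (hF : ∀ i ∈ s, Continuous (F i)) :
    orthMean B (fun C => ∑ i ∈ s, F i C) = ∑ i ∈ s, orthMean B (F i) := by
  rw [orthMean]
  have : ∀ Q : OrthGroup m, ∫ R : OrthGroup d, ∑ i ∈ s, F i ((Q : Matrix (Fin m) (Fin m) ℝ) * B *
      (R : Matrix (Fin d) (Fin d) ℝ).transpose) ∂(orthHaar d) =
      ∑ i ∈ s, ∫ R : OrthGroup d, F i ((Q : Matrix (Fin m) (Fin m) ℝ) * B *
      (R : Matrix (Fin d) (Fin d) ℝ).transpose) ∂(orthHaar d) := fun Q =>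
    integral_finsetSum s fun i hi => integrable_inner_orthMean B (hF i hi) Q
  simp only [this]
  exact integral_finsetSum s fun i hi => integrable_outer_orthMean B (hF i hi)

theorem orthMean_const_mul (c : ℝ) (F : Matrix (Fin m) (Fin d) ℝ → ℝ) :
    orthMean B (fun C => c * F C) = c * orthMean B F := by
  simp only [orthMean, integral_const_mul]

theorem orthMean_eq_of_forall {c : ℝ} (h : ∀ (Q : OrthGroup m) (R : OrthGroup d),
    F ((Q : Matrix (Fin m) (Fin m) ℝ) * B * (R : Matrix (Fin d) (Fin d) ℝ).transpose) = c) :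
    orthMean B F = c := by
  simp [orthMean, h]

/-- Left invariance suffices for both factors: because of the transpose on `R`, right multiplication
by `P'ᵀ` is the translation `R ↦ P' R`. -/
theorem orthMean_orthogonal (F : Matrix (Fin m) (Fin d) ℝ → ℝ) {P : Matrix (Fin m) (Fin m) ℝ}
    (hP : P ∈ orthogonalGroup (Fin m) ℝ) {P' : Matrix (Fin d) (Fin d) ℝ}
    (hP' : P' ∈ orthogonalGroup (Fin d) ℝ) :
    orthMean B (fun C => F (P * C * P'.transpose)) = orthMean B F := by
  have h1 : ∀ Q : Matrix (Fin m) (Fin m) ℝ, ∫ R : OrthGroup d,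
      F (P * (Q * B * (R : Matrix (Fin d) (Fin d) ℝ).transpose) * P'.transpose) ∂(orthHaar d) =
      ∫ R : OrthGroup d, F (P * Q * B * (R : Matrix (Fin d) (Fin d) ℝ).transpose)
        ∂(orthHaar d) := fun Q => by
    rw [← integral_mul_left_eq_self (fun R : OrthGroup d =>
      F (P * Q * B * (R : Matrix (Fin d) (Fin d) ℝ).transpose)) (⟨P', hP'⟩ : OrthGroup d)]
    simp [transpose_mul, Matrix.mul_assoc]
  simp only [orthMean, h1]
  exact integral_mul_left_eq_self (fun Q : OrthGroup m => ∫ R : OrthGroup d,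
    F ((Q : Matrix (Fin m) (Fin m) ℝ) * B * (R : Matrix (Fin d) (Fin d) ℝ).transpose)
    ∂(orthHaar d)) (⟨P, hP⟩ : OrthGroup m)

theorem orthMean_signs (F : Matrix (Fin m ⊕ Fin d) (Fin m ⊕ Fin d) ℝ → ℝ) {e : Fin m ⊕ Fin d → ℝ}
    (he : ∀ i, e i * e i = 1) :
    orthMean B (fun C => F (diagonal e * dilation C * diagonal e)) =
      orthMean B fun C => F (dilation C) := by
  have h : ∀ {n : ℕ} {a : Fin n → ℝ}, (∀ i, a i * a i = 1) →
      diagonal a ∈ orthogonalGroup (Fin n) ℝ := fun {n a} ha => by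
    rw [mem_orthogonalGroup_iff, diagonal_transpose, diagonal_mul_diagonal]
    simp [ha]
  rw [← orthMean_orthogonal B (fun C => F (dilation C)) (h fun i => he (Sum.inl i))
    (h fun i => he (Sum.inr i))]
  congr 1
  ext C
  congr 1
  ext (i | i) (j | j) <;> simp [dilation, mul_diagonal, diagonal_mul]
  ring

theorem orthMean_perm (F : Matrix (Fin m ⊕ Fin d) (Fin m ⊕ Fin d) ℝ → ℝ)
    (π : Equiv.Perm (Fin m)) (ρ : Equiv.Perm (Fin d)) :
    orthMean B (fun C => F ((dilation C).submatrix (π.sumCongr ρ) (π.sumCongr ρ))) =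
      orthMean B fun C => F (dilation C) := by
  have h : ∀ {n : ℕ} (σ : Equiv.Perm (Fin n)), (1 : Matrix (Fin n) (Fin n) ℝ).submatrix σ id ∈
      orthogonalGroup (Fin n) ℝ := fun {n} σ => by
    rw [mem_orthogonalGroup_iff]
    ext i j
    simp [mul_apply, one_apply]
  rw [← orthMean_orthogonal B (fun C => F (dilation C)) (h π) (h ρ)]
  congr 1
  ext C
  congr 1
  have h2 : (1 : Matrix (Fin m) (Fin m) ℝ).submatrix π id * C *
      ((1 : Matrix (Fin d) (Fin d) ℝ).submatrix ρ id).transpose = C.submatrix π ρ := by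
    ext i j
    simp [mul_apply, one_apply]
  rw [h2]
  ext (i | i) (j | j) <;> simp [dilation]

/-- The mean of the principal minors of the dilation of `Q B Rᵀ`. -/
noncomputable def meanMinor (V : Finset (Fin m ⊕ Fin d)) : ℝ :=
  orthMean B fun C => principalMinor V (dilation C)

/-- Take the rows in `V` from `M`. In the Leibniz expansion, permutations moving an index out of `V`
average to zero, so the columns in `V` may be cleared from the remaining rows, and
`det_rowMix_truncated` factors the determinant. -/
theorem orthMean_det_add (M : Matrix (Fin m ⊕ Fin d) (Fin m ⊕ Fin d) ℝ) (c : Fin m ⊕ Fin d → ℝ) :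
    orthMean B (fun C => (M + (diagonal c + dilation C)).det) =
      ∑ V : Finset (Fin m ⊕ Fin d), principalMinor V M *
        orthMean B fun C => principalMinor Vᶜ (diagonal c + dilation C) := by
  have hY : Continuous fun C : Matrix (Fin m) (Fin d) ℝ => diagonal c + dilation C :=
    continuous_const.add continuous_dilation
  have hmix : ∀ (V : Finset (Fin m ⊕ Fin d)) (i j : Fin m ⊕ Fin d),
      Continuous fun C : Matrix (Fin m) (Fin d) ℝ => rowMix V M (diagonal c + dilation C) i j := by
    intro V i j
    simp only [rowMix_apply]
    split_ifs
    · exact continuous_const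
    · exact hY.matrix_elem i j
  simp only [det_add_eq_sum_rowMix M]
  rw [orthMean_finset_sum B _ fun V _ => (continuous_matrix (hmix V)).matrix_det]
  refine Finset.sum_congr rfl fun V _ => ?_
  rw [← orthMean_const_mul]
  simp only [← det_rowMix_truncated]
  have htr : ∀ i j : Fin m ⊕ Fin d, Continuous fun C : Matrix (Fin m) (Fin d) ℝ => rowMix V M
      (of fun i j => if j ∈ V then 0 else (diagonal c + dilation C) i j) i j := by
    intro i j
    simp only [rowMix_apply, of_apply]
    split_ifs
    · exact continuous_const
    · exact continuous_const
    · exact hY.matrix_elem i j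
  simp only [det_apply']
  rw [orthMean_finset_sum B Finset.univ
      (F := fun (σ : Equiv.Perm (Fin m ⊕ Fin d)) C => ((Equiv.Perm.sign σ : ℤ) : ℝ) *
        ∏ i, rowMix V M (diagonal c + dilation C) (σ i) i)
      fun σ _ => continuous_const.mul (continuous_finsetProd _ fun i _ => hmix V (σ i) i),
    orthMean_finset_sum B Finset.univ
      (F := fun (σ : Equiv.Perm (Fin m ⊕ Fin d)) C => ((Equiv.Perm.sign σ : ℤ) : ℝ) *
        ∏ i, rowMix V M (of fun i j => if j ∈ V then 0 else (diagonal c + dilation C) i j) (σ i) i)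
      fun σ _ => continuous_const.mul (continuous_finsetProd _ fun i _ => htr (σ i) i)]
  refine Finset.sum_congr rfl fun σ _ => ?_
  rw [orthMean_const_mul, orthMean_const_mul]
  congr 1
  by_cases h : ∃ i ∈ V, σ i ∉ V
  · obtain ⟨i₀, hi₀, hσ⟩ := h
    have hr : ∀ C : Matrix (Fin m) (Fin d) ℝ, ∏ i, rowMix V M
        (of fun i j => if j ∈ V then 0 else (diagonal c + dilation C) i j) (σ i) i = 0 :=
      fun C => Finset.prod_eq_zero (Finset.mem_univ i₀) (by simp [rowMix_apply, hσ, hi₀])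
    simp only [hr]
    rw [orthMean_eq_of_forall B (F := fun _ => 0) fun _ _ => rfl]
    -- Flipping coordinate `i₀` negates exactly one factor, in column `i₀`: row `i₀` is taken from
    -- `M`, and row `σ i₀` from the random matrix.
    set e : Fin m ⊕ Fin d → ℝ := fun i => if i = i₀ then -1 else 1 with he
    have hee : ∀ i, e i * e i = 1 := fun i => by
      simp only [he]
      split_ifs <;> norm_num
    have hs := orthMean_signs B (fun Z => ∏ i, rowMix V M (diagonal c + Z) (σ i) i) hee
    have hflip : ∀ C : Matrix (Fin m) (Fin d) ℝ,
        ∏ i, rowMix V M (diagonal c + diagonal e * dilation C * diagonal e) (σ i) i =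
        -1 * ∏ i, rowMix V M (diagonal c + dilation C) (σ i) i := by
      intro C
      have h1 : ∀ i, rowMix V M (diagonal c + diagonal e * dilation C * diagonal e) (σ i) i =
          (if i = i₀ then -1 else 1) * rowMix V M (diagonal c + dilation C) (σ i) i := by
        intro i
        rw [rowMix_apply, rowMix_apply]
        by_cases hi : σ i ∈ V
        · have : i ≠ i₀ := fun h => hσ (h ▸ hi)
          simp [hi, this]
        · have h2 : σ i ≠ i₀ := fun h => hi (h ▸ hi₀)
          have h3 : e (σ i) = 1 := if_neg h2
          rw [if_neg hi, if_neg hi, Matrix.add_apply, Matrix.add_apply, mul_diagonal, diagonal_mul, h3, one_mul]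
          -- The unflipped diagonal `c` enters only at fixed points of `σ`, and these differ from
          -- `i₀`.
          by_cases h4 : σ i = i
          · have h5 : i ≠ i₀ := fun h => h2 (h4.trans h)
            simp [he, h5]
          · rw [diagonal_apply_ne _ h4, zero_add, zero_add, mul_comm]
      rw [Finset.prod_congr rfl fun i _ => h1 i, Finset.prod_mul_distrib,
        Finset.prod_ite_eq' Finset.univ i₀ fun _ => (-1 : ℝ), if_pos (Finset.mem_univ _)]
    simp only [hflip] at hs
    rw [orthMean_const_mul] at hs
    linarith
  · push Not at h
    congr 1
    ext C
    refine Finset.prod_congr rfl fun i _ => ?_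
    rw [rowMix_apply, rowMix_apply]
    by_cases hi : i ∈ V
    · rw [if_pos (h i hi), if_pos (h i hi)]
    · simp [hi]

theorem orthMean_principalMinor_diagonal_add (S : Finset (Fin m ⊕ Fin d))
    (c : Fin m ⊕ Fin d → ℝ) :
    orthMean B (fun C => principalMinor S (diagonal c + dilation C)) =
      ∑ W ∈ S.powerset, (∏ i ∈ S \ W, c i) * meanMinor B W := by
  simp only [principalMinor_diagonal_add]
  rw [orthMean_finset_sum B S.powerset
    (F := fun W C => (∏ i ∈ S \ W, c i) * principalMinor W (dilation C))
    fun W _ => continuous_const.mul ((continuous_principalMinor W).comp continuous_dilation)]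
  simp only [orthMean_const_mul, meanMinor]

theorem meanMinor_eq_zero {V : Finset (Fin m ⊕ Fin d)} (hV : V.toLeft.card ≠ V.toRight.card) :
    meanMinor B V = 0 :=
  orthMean_eq_of_forall B fun _ _ => principalMinor_dilation_eq_zero hV _

theorem exists_perm_map_eq {α : Type*} [Fintype α] [DecidableEq α] {s t : Finset α}
    (h : s.card = t.card) : ∃ π : Equiv.Perm α, s.map π.toEmbedding = t := by
  let e : {x // x ∈ s} ≃ {x // x ∈ t} := Finset.equivOfCardEq h
  refine ⟨e.extendSubtype, Finset.eq_of_subset_of_card_le (fun x hx => ?_) (by simp [h])⟩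
  obtain ⟨y, hy, rfl⟩ := Finset.mem_map.1 hx
  exact e.extendSubtype_mem y hy

theorem meanMinor_congr {V W : Finset (Fin m ⊕ Fin d)} (hl : V.toLeft.card = W.toLeft.card)
    (hr : V.toRight.card = W.toRight.card) : meanMinor B V = meanMinor B W := by
  obtain ⟨π, hπ⟩ := exists_perm_map_eq hl
  obtain ⟨ρ, hρ⟩ := exists_perm_map_eq hr
  have h : V.map (π.sumCongr ρ).toEmbedding = W := by
    rw [← Finset.toLeft_disjSum_toRight (u := W), ← hπ, ← hρ]
    ext (i | i) <;> simp
  rw [meanMinor, meanMinor, ← orthMean_perm B (principalMinor V) π ρ]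
  simp only [principalMinor_submatrix, h]

theorem singCharpoly_orthogonal (Q : OrthGroup m) (R : OrthGroup d) :
    singCharpoly ((Q : Matrix (Fin m) (Fin m) ℝ) * B *
      (R : Matrix (Fin d) (Fin d) ℝ).transpose) = singCharpoly B := by
  have hQ : (Q : Matrix (Fin m) (Fin m) ℝ).transpose * (Q : Matrix (Fin m) (Fin m) ℝ) = 1 :=
    (mem_orthogonalGroup_iff' _ _).1 Q.2
  have hR : (R : Matrix (Fin d) (Fin d) ℝ).transpose * (R : Matrix (Fin d) (Fin d) ℝ) = 1 :=
    (mem_orthogonalGroup_iff' _ _).1 R.2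
  have h : ((Q : Matrix (Fin m) (Fin m) ℝ) * B * (R : Matrix (Fin d) (Fin d) ℝ).transpose).transpose *
      ((Q : Matrix (Fin m) (Fin m) ℝ) * B * (R : Matrix (Fin d) (Fin d) ℝ).transpose) =
      (R : Matrix (Fin d) (Fin d) ℝ) * (B.transpose *
        ((Q : Matrix (Fin m) (Fin m) ℝ).transpose * (Q : Matrix (Fin m) (Fin m) ℝ)) * B *
        (R : Matrix (Fin d) (Fin d) ℝ).transpose) := by
    simp only [transpose_mul, transpose_transpose, Matrix.mul_assoc]
  rw [singCharpoly, h, hQ, charpoly_mul_comm, Matrix.mul_assoc, hR, Matrix.mul_one,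
    Matrix.mul_one, singCharpoly]

/-- The sum of minors is a coefficient of `singCharpoly`, which is constant on the orbit of `B`. -/
theorem sum_meanMinor {j : ℕ} (hj : j ≤ d) :
    ∑ V : Finset (Fin m ⊕ Fin d) with V.toRight.card = j, meanMinor B V =
      (singCharpoly B).coeff (d - j) := by
  simp only [meanMinor]
  rw [← orthMean_finset_sum B _ (F := fun V C => principalMinor V (dilation C))
    fun V _ => (continuous_principalMinor V).comp continuous_dilation]
  refine orthMean_eq_of_forall B fun Q R => ?_
  rw [← coeff_singCharpoly _ hj, singCharpoly_orthogonal]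

end orthMean

end OrthogonalMean

/-! ### Evaluation of the Haar average -/

section HaarFormula

open Matrix

variable {m d : ℕ}

theorem sum_powerset_balanced {α β : Type*} [DecidableEq α] [DecidableEq β] (U : Finset (α ⊕ β))
    (h : ℕ → ℝ) :
    ∑ W ∈ U.powerset, (if W.toLeft.card = W.toRight.card then h W.toRight.card else 0) =
      ∑ b ∈ Finset.range (U.toRight.card + 1),
        (U.toLeft.card.choose b * U.toRight.card.choose b : ℝ) * h b := by
  have h1 : ∑ W ∈ U.powerset, (if W.toLeft.card = W.toRight.card then h W.toRight.card else 0) =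
      ∑ P ∈ U.toRight.powerset ×ˢ U.toLeft.powerset,
        (if P.2.card = P.1.card then h P.1.card else 0) := by
    refine Finset.sum_nbij' (fun W => (W.toRight, W.toLeft)) (fun P => P.2.disjSum P.1) ?_ ?_ ?_ ?_ ?_
    · intro W hW
      rw [Finset.mem_powerset] at hW
      simp [Finset.toLeft_subset_toLeft hW, Finset.toRight_subset_toRight hW]
    · intro P hP
      rw [Finset.mem_product, Finset.mem_powerset, Finset.mem_powerset] at hP
      rw [Finset.mem_powerset, Finset.disjSum_subset]
      exact ⟨hP.2, hP.1⟩
    · intro W _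
      simp [Finset.toLeft_disjSum_toRight]
    · intro P _
      simp
    · intro W _
      rfl
  have h2 : ∀ b : ℕ, ∑ S ∈ U.toLeft.powerset, (if S.card = b then h b else 0) =
      U.toLeft.card.choose b * h b := by
    intro b
    rw [← Finset.sum_filter, Finset.sum_const, nsmul_eq_mul, ← Finset.powersetCard_eq_filter,
      Finset.card_powersetCard]
  rw [h1, Finset.sum_product]
  simp only [h2]
  rw [Finset.sum_powerset_apply_card fun b => (U.toLeft.card.choose b : ℝ) * h b]
  exact Finset.sum_congr rfl fun b _ => by rw [nsmul_eq_mul]; ring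

/-- Balanced sets with `j` right indices number `m.choose j * d.choose j` and share one mean minor,
while their total is given by `sum_meanMinor`. -/
theorem meanMinor_eq (B : Matrix (Fin m) (Fin d) ℝ) (hdm : d ≤ m) (W : Finset (Fin m ⊕ Fin d)) :
    meanMinor B W = if W.toLeft.card = W.toRight.card then
      (singCharpoly B).coeff (d - W.toRight.card) /
        (m.choose W.toRight.card * d.choose W.toRight.card) else 0 := by
  split_ifs with hW
  · set j := W.toRight.card with hj
    have hjd : j ≤ d := card_toRight_le W
    -- An indicator at `j` turns the counting identity into the number of such sets times their
    -- common value.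
    have h := sum_powerset_balanced (Finset.univ : Finset (Fin m ⊕ Fin d))
      fun b => if b = j then meanMinor B W else 0
    have hl : (Finset.univ : Finset (Fin m ⊕ Fin d)).toLeft.card = m := by
      have : (Finset.univ : Finset (Fin m ⊕ Fin d)).toLeft = Finset.univ := by ext; simp
      rw [this, Finset.card_univ, Fintype.card_fin]
    have hr : (Finset.univ : Finset (Fin m ⊕ Fin d)).toRight.card = d := by
      have : (Finset.univ : Finset (Fin m ⊕ Fin d)).toRight = Finset.univ := by ext; simp
      rw [this, Finset.card_univ, Fintype.card_fin]
    rw [hl, hr, Finset.sum_eq_single_of_mem j (Finset.mem_range.2 (Nat.lt_succ_of_le hjd))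
      fun b _ hb => by rw [if_neg hb, mul_zero], if_pos rfl, Finset.powerset_univ] at h
    rw [← sum_meanMinor B hjd, Finset.sum_filter, eq_div_iff, mul_comm, ← h]
    · refine Finset.sum_congr rfl fun V _ => ?_
      by_cases h1 : V.toRight.card = j
      · by_cases h2 : V.toLeft.card = V.toRight.card
        · rw [if_pos h2, if_pos h1, if_pos h1]
          exact meanMinor_congr B (by omega) (by omega)
        · rw [if_neg h2, if_pos h1, meanMinor_eq_zero B h2]
      · simp [h1]
    · have h1 := Nat.choose_pos hjd
      have h2 := Nat.choose_pos (hjd.trans hdm)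
      positivity
  · exact meanMinor_eq_zero B hW

theorem eval_haarConv (A B : Matrix (Fin m) (Fin d) ℝ) (y : ℝ) :
    (haarConv A B).eval y = orthMean B fun C => (singCharpoly (A + C)).eval y := by
  have h : ∀ C, (singCharpoly (A + C)).eval y =
      ∑ k ∈ Finset.range (d + 1), y ^ k * (singCharpoly (A + C)).coeff k := fun C => by
    rw [eval_eq_sum_range, natDegree_singCharpoly]
    exact Finset.sum_congr rfl fun k _ => mul_comm _ _
  simp only [h]
  rw [orthMean_finset_sum B _ (F := fun k C => y ^ k * (singCharpoly (A + C)).coeff k)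
    fun k hk => continuous_const.mul ((continuous_coeff_singCharpoly
      (Nat.lt_succ_iff.1 (Finset.mem_range.1 hk))).comp (continuous_const.add continuous_id)),
    haarConv, eval_finsetSum]
  refine Finset.sum_congr rfl fun k _ => ?_
  rw [orthMean_const_mul, eval_mul, eval_C, eval_pow, eval_X, mul_comm]
  rfl

/-- The Haar average depends only on the two characteristic polynomials. -/
theorem haarConv_eq_rectForm (hdm : d ≤ m) (A B : Matrix (Fin m) (Fin d) ℝ) :
    haarConv A B = rectForm m d (singCharpoly A) (singCharpoly B) := by
  refine Polynomial.funext fun y => ?_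
  set κ : ℕ → ℝ := fun j => (singCharpoly B).coeff (d - j) / (m.choose j * d.choose j) with hκ
  set Φ : ℕ → ℝ := fun i => ∑ j ∈ Finset.range (d + 1),
    ((m - i).choose j * (d - i).choose j : ℝ) * (y ^ (d - i - j) * κ j) with hΦ
  have h1 : ∀ C, (singCharpoly (A + C)).eval y =
      (dilation A + (diagonal (Sum.elim (fun _ => 1) fun _ => y) + dilation C)).det := fun C => by
    rw [eval_singCharpoly, dilation_add]
    congr 1
    abel
  rw [eval_haarConv]
  simp only [h1]
  rw [orthMean_det_add]
  have h2 : ∀ V : Finset (Fin m ⊕ Fin d), principalMinor V (dilation A) * orthMean B (fun C =>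
      principalMinor Vᶜ (diagonal (Sum.elim (fun _ => 1) fun _ => y) + dilation C)) =
      principalMinor V (dilation A) * Φ V.toRight.card := by
    intro V
    by_cases hV : V.toLeft.card = V.toRight.card
    · rw [orthMean_principalMinor_diagonal_add]
      congr 1
      have h3 : ∀ W ∈ Vᶜ.powerset,
          (∏ i ∈ Vᶜ \ W, Sum.elim (fun _ : Fin m => (1 : ℝ)) (fun _ : Fin d => y) i) *
            meanMinor B W =
          if W.toLeft.card = W.toRight.card then
            y ^ (d - V.toRight.card - W.toRight.card) * κ W.toRight.card else 0 := by
        intro W hW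
        rw [Finset.mem_powerset] at hW
        rw [prod_sumElim_const, one_pow, one_mul, Finset.toRight_sdiff,
          Finset.card_sdiff_of_subset (Finset.toRight_subset_toRight hW), card_compl_toRight,
          meanMinor_eq B hdm, mul_ite, mul_zero]
      rw [Finset.sum_congr rfl h3,
        sum_powerset_balanced Vᶜ fun j => y ^ (d - V.toRight.card - j) * κ j, card_compl_toRight,
        card_compl_toLeft, hV]
      refine Finset.sum_subset (Finset.range_subset_range.2 (by omega)) fun j _ hj => ?_
      rw [Finset.mem_range] at hj
      rw [Nat.choose_eq_zero_of_lt (show d - V.toRight.card < j by omega)]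
      simp
    · rw [principalMinor_dilation_eq_zero hV, zero_mul, zero_mul]
  -- Grouping by the number of right indices reassembles the minors of `A` into coefficients of
  -- `singCharpoly A`.
  rw [Finset.sum_congr rfl fun V _ => h2 V, ← Finset.sum_fiberwise_of_maps_to
    (t := Finset.range (d + 1)) (g := fun V : Finset (Fin m ⊕ Fin d) => V.toRight.card)
    fun V _ => Finset.mem_range.2 (Nat.lt_succ_of_le (card_toRight_le V)), rectForm, eval_finsetSum]
  refine Finset.sum_congr rfl fun i hi => ?_
  rw [coeff_singCharpoly A (Nat.lt_succ_iff.1 (Finset.mem_range.1 hi)), eval_finsetSum]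
  have h4 : ∀ V ∈ Finset.univ.filter fun V : Finset (Fin m ⊕ Fin d) => V.toRight.card = i,
      principalMinor V (dilation A) * Φ V.toRight.card =
        principalMinor V (dilation A) * Φ i := fun V hV => by
    rw [(Finset.mem_filter.1 hV).2]
  rw [Finset.sum_congr rfl h4, ← Finset.sum_mul, hΦ, Finset.mul_sum]
  refine Finset.sum_congr rfl fun j _ => ?_
  rw [eval_mul, eval_C, eval_pow, eval_X, hκ]
  ring

/-! ### Realizing matrices and symmetrized roots -/

namespace IsNonnegRooted

variable {p q : ℝ[X]}

/-- A rectangular diagonal matrix of square roots of the roots works; `d ≤ m` leaves room for its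
diagonal. -/
theorem exists_singCharpoly_eq (hdm : d ≤ m) (hp : IsNonnegRooted d p) :
    ∃ A : Matrix (Fin m) (Fin d) ℝ, singCharpoly A = p := by
  have hlen : p.roots.toList.length = d := by rw [Multiset.length_toList, hp.card_roots]
  set r : Fin d → ℝ := fun j => p.roots.toList.get (j.cast hlen.symm) with hr
  have hr0 : ∀ j, 0 ≤ r j := fun j =>
    hp.nonneg_of_mem_roots _ (Multiset.mem_toList.1 (List.get_mem _ _))
  refine ⟨of fun i j => if i = Fin.castLE hdm j then √(r j) else 0, ?_⟩
  have h : (of fun (i : Fin m) (j : Fin d) => if i = Fin.castLE hdm j then √(r j) else 0).transpose *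
      (of fun (i : Fin m) (j : Fin d) => if i = Fin.castLE hdm j then √(r j) else 0) =
      diagonal r := by
    ext i j
    rw [mul_apply, Finset.sum_eq_single_of_mem (Fin.castLE hdm i) (Finset.mem_univ _)]
    · by_cases hij : i = j
      · subst hij
        simp [hr0]
      · simp [hij]
    · intro k _ hk
      simp [hk]
  rw [singCharpoly, h, charpoly_diagonal]
  conv_rhs => rw [hp.eq_prod]
  rw [← List.prod_ofFn]
  congr 1
  refine List.ext_get (by simp [hlen]) fun n h1 h2 => ?_
  simp [hr]

theorem roots_symmetrization (hp : IsNonnegRooted d p) :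
    (symmetrization p).roots = (p.roots.map fun r => √r) + p.roots.map fun r => -√r := by
  have h : symmetrization p =
      ((((p.roots.map fun r => √r) + p.roots.map fun r => -√r).map fun a => X - C a)).prod := by
    rw [symmetrization]
    conv_lhs => rw [hp.splits.eq_prod_roots_of_monic hp.monic]
    rw [multiset_prod_comp, Multiset.map_map, Multiset.map_add, Multiset.prod_add,
      Multiset.map_map, Multiset.map_map, ← Multiset.prod_map_mul]
    refine congrArg _ (Multiset.map_congr rfl fun r hr => ?_)
    have hs : C √r * C √r = (C r : ℝ[X]) := by
      rw [← C_mul, Real.mul_self_sqrt (hp.nonneg_of_mem_roots r hr)]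
    simp only [Function.comp_apply, sub_comp, X_comp, C_comp, C_neg]
    linear_combination hs
  rw [h, roots_multiset_prod_X_sub_C]

theorem natDegree_symmetrization (hp : IsNonnegRooted d p) :
    (symmetrization p).natDegree = d * 2 := by
  rw [symmetrization, natDegree_comp, hp.natDegree_eq, natDegree_X_pow]

theorem rootMean_symmetrization (hp : IsNonnegRooted d p) : rootMean (symmetrization p) = 0 := by
  rw [rootMean, hp.roots_symmetrization, Multiset.sum_add, Multiset.sum_map_neg, add_neg_cancel,
    zero_div]

/-- The `2d` roots `±√r` have mean zero, so their variance is the mean of the roots of `p`, read off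
by Vieta. -/
theorem rootVar_symmetrization (hd : 0 < d) (hp : IsNonnegRooted d p) :
    rootVar (symmetrization p) = -p.coeff (d - 1) / d := by
  have hsum : p.coeff (d - 1) = -p.roots.sum := by
    have h := hp.splits.nextCoeff_eq_neg_sum_roots_of_monic hp.monic
    rwa [nextCoeff_of_natDegree_pos (by rw [hp.natDegree_eq]; exact hd), hp.natDegree_eq] at h
  have hsq : (p.roots.map fun r => √r ^ 2).sum = p.roots.sum := by
    conv_rhs => rw [← Multiset.map_id p.roots]
    exact congrArg _ (Multiset.map_congr rfl fun r hr => Real.sq_sqrt (hp.nonneg_of_mem_roots r hr))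
  have hd' : (d : ℝ) ≠ 0 := by exact_mod_cast hd.ne'
  rw [rootVar, hp.rootMean_symmetrization, hp.roots_symmetrization, hp.natDegree_symmetrization,
    Multiset.map_add, Multiset.sum_add, Multiset.map_map, Multiset.map_map]
  simp only [Function.comp_def, sub_zero, neg_sq, hsq, hsum]
  push_cast
  field_simp
  ring

end IsNonnegRooted

end HaarFormula

theorem mainTheorem11 (d m : ℕ) (hd : 0 < d) (hdm : d ≤ m) (p q : ℝ[X])
    (hp : IsNonnegRooted d p) (hq : IsNonnegRooted d q) :
    (∀ A B : Matrix (Fin m) (Fin d) ℝ, singCharpoly A = p → singCharpoly B = q →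
      rectConv m d p q = haarConv A B) ∧
    IsNonnegRooted d (rectConv m d p q) ∧
    (rootMean (symmetrization (rectConv m d p q)) =
        rootMean (symmetrization p) + rootMean (symmetrization q) ∧
      rootMean (symmetrization p) + rootMean (symmetrization q) = 0) ∧
    rootVar (symmetrization (rectConv m d p q)) =
      rootVar (symmetrization p) + rootVar (symmetrization q) := by
  have hconv : rectConv m d p q = rectForm m d p q := by
    have h : (∃ A : Matrix (Fin m) (Fin d) ℝ, singCharpoly A = p) ∧
        (∃ B : Matrix (Fin m) (Fin d) ℝ, singCharpoly B = q) :=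
      ⟨hp.exists_singCharpoly_eq hdm, hq.exists_singCharpoly_eq hdm⟩
    -- The chosen matrices enter only through their characteristic polynomials, so the choice is
    -- immaterial.
    rw [rectConv, dif_pos h, haarConv_eq_rectForm hdm, h.1.choose_spec, h.2.choose_spec]
  have hpq := hp.rectForm hdm hq
  have hpc : p.coeff d = 1 := by
    have := hp.monic.coeff_natDegree
    rwa [hp.natDegree_eq] at this
  have hqc : q.coeff d = 1 := by
    have := hq.monic.coeff_natDegree
    rwa [hq.natDegree_eq] at this
  refine ⟨?_, ?_, ⟨?_, ?_⟩, ?_⟩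
  · rintro A B rfl rfl
    rw [hconv, haarConv_eq_rectForm hdm]
  · rwa [hconv]
  · rw [hconv, hpq.rootMean_symmetrization, hp.rootMean_symmetrization, hq.rootMean_symmetrization,
      add_zero]
  · rw [hp.rootMean_symmetrization, hq.rootMean_symmetrization, add_zero]
  · rw [hconv, hpq.rootVar_symmetrization hd, hp.rootVar_symmetrization hd,
      hq.rootVar_symmetrization hd, coeff_rectForm_pred hd hdm, hpc, hqc]
    ring
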